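/- **Notation.** For probability measures $P,Q$ on $\mathbb R$, let $D_\alpha(P\|Q)\in[0,\infty]$ denote the Rényi divergence of order $\alpha\in[0,\infty]$ (natural logarithm): $D_\alpha(P\|Q)=\frac1{\alpha-1}\log\int\left(\frac{dP}{dQ}\right)^{\alpha}dQ$ for $\alpha\in(0,1)\cup(1,\infty)$, where $dP/dQ$ is the density of the part of $P$ that is absolutely continuous with respect to $Q$; $D_0(P\|Q)=\lim_{\alpha\downarrow0}D_\alpha(P\|Q)=-\log Q\left(\frac{dP}{dQ}>0\right)$; $D_1(P\|Q)=\int\log\frac{dP}{dQ}\,dP$ is the relative entropy; $D_\infty(P\|Q)=\log\operatorname{ess\,sup}_P\frac{dP}{dQ}$; and $D_\alpha(P\|Q)=\infty$ if $\alpha\ge1$ and $P\not\ll Q$. For a Borel set $\mathcal A\subseteq\mathbb R$ let $\mathcal P_{\mathrm{ac}}(\mathcal A)$ be the set of probability measures on $\mathbb R$ that are absolutely continuous with respect to Lebesgue measure and satisfy $P(\mathbb R\setminus\mathcal A)=0$; put $\mathcal P_{\mathrm{ac}}=\mathcal P_{\mathrm{ac}}(\mathbb R)$. For a partition $\{\mathcal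 A_i\}$ of $\mathcal A$ into countably many intervals of finite length, let $P_{|\{\mathcal A_i\}}$ be the cell-averaged version of $P$, i.e. the measure with density $\sum_i\frac{P(\mathcal A_i)}{|\mathcal A_i|}1\{x\in\mathcal A_i\}$ (cells of length $0$ contribute nothing), and let $$\mathcal P_{\mathrm{ac}}^{(\alpha)}(\mathcal A)=\left\{P\in\mathcal P_{\mathrm{ac}}(\mathcal A):\ \lim_{\Delta\downarrow0}\ \sup_{\{\mathcal A_i\}:\ \sup_i|\mathcal A_i|\le\Delta}D_\alpha\left(P\,\middle\|\,P_{|\{\mathcal A_i\}}\right)=0\right\},$$ the supremum being over all such partitions (the class is empty if $\mathcal A$ has no such partition). For a set $\mathcal P$ of probability measures on $\mathbb R$ and a probability measure $Q_Y$ on $\mathbb R$, let $\mathcal E^{(\alpha)}_{\mathrm{Renyi}}(\mathcal P,Q_Y)$ be the set of functions $g:\mathcal P\to\mathbb R$ for which there is one sequence of measurable functions $f_k:\mathbb R\to\mathbb R$ such that $\limsup_{k\to\infty}D_\alpha(P\circ f_k^{-1}\|Q_Y)\le g(P)$ for every $P\in\mathcal P$. Write $\mathcal E^{(\alpha)}_{\mathrm{Renyi}}(\mathcal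 P,Q_Y)\asymp0$ if some $g$ in this set satisfies $g(P)\le0$ for all $P\in\mathcal P$, and every $g$ in this set satisfies $g(P)\ge0$ for all $P\in\mathcal P$. **Theorem.** Let $\alpha\in[0,\infty]$, let $\mathcal A\subseteq\mathbb R$ be a Borel set, let $Q_Y$ be an arbitrary probability measure on $\mathbb R$, and let $$\mathcal P_X=\begin{cases}\mathcal P_{\mathrm{ac}},&\alpha\in[0,1),\\ \mathcal P_{\mathrm{ac}}^{(\alpha)}(\mathcal A),&\alpha\in[1,\infty].\end{cases}$$ Then $\mathcal E^{(\alpha)}_{\mathrm{Renyi}}(\mathcal P_X,Q_Y)\asymp0$. In particular there is a sequence of measurable functions $f_k:\mathbb R\to\mathbb R$, depending only on $\alpha,\mathcal A,Q_Y$, with $\lim_{k\to\infty}D_\alpha(P\circ f_k^{-1}\|Q_Y)=0$ for all $P\in\mathcal P_X$ simultaneously. -/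

import Mathlib

open MeasureTheory Filter Topology Set
open scoped ENNReal

noncomputable section

namespace UniversalSimulation

/-! ### Rényi divergence -/

open scoped Classical in
/-- The Rényi divergence `D_α(P‖Q)` of order `α ∈ [0, ∞]`, in nats, with values in `[-∞, ∞]`.
For `α ∈ (0, 1) ∪ (1, ∞)` it is `(α - 1)⁻¹ log ∫ (dP/dQ)^α dQ`, where for `α > 1` the value is
`∞` if `P` is not absolutely continuous with respect to `Q` (for `α < 1` the part of `P` that is
singular to `Q` does not contribute to the integral `∫ p^α q^(1-α)`).  The orders `1`, `∞`
are the relative entropy and `log esssup_P dP/dQ`; order `0` is the limit as `α ↓ 0`, see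
`tendsto_renyiDiv_zero`. -/
def renyiDiv (α : ℝ≥0∞) (P Q : Measure ℝ) : EReal :=
  if α = 0 then - ENNReal.log (Q {x | 0 < P.rnDeriv Q x})
  else if α = 1 then (InformationTheory.klDiv P Q : EReal)
  else if 1 < α ∧ ¬ P ≪ Q then ⊤
  else if α = ∞ then ENNReal.log (essSup (P.rnDeriv Q) P)
  else (((α.toReal - 1)⁻¹ : ℝ) : EReal) *
    ENNReal.log (∫⁻ x, (P.rnDeriv Q x) ^ α.toReal ∂Q)

/-- The divergence of order `0` is the continuous extension of those of order in `(0, 1)`. -/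
theorem tendsto_renyiDiv_zero (P Q : Measure ℝ) [IsProbabilityMeasure P]
    [IsProbabilityMeasure Q] :
    Tendsto (fun α : ℝ≥0∞ => renyiDiv α P Q) (𝓝[>] 0) (𝓝 (renyiDiv 0 P Q)) := by
  have hlt : ∀ᶠ α : ℝ≥0∞ in 𝓝[>] 0, 0 < α ∧ α < 1 :=
    (eventually_mem_nhdsWithin).and
      (mem_nhdsWithin_of_mem_nhds (Iio_mem_nhds (by norm_num)))
  have hre : Tendsto (fun α : ℝ≥0∞ => α.toReal) (𝓝[>] 0) (𝓝 0) := by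
    have := ENNReal.tendsto_toReal (a := 0) (by simp)
    simpa using this.mono_left nhdsWithin_le_nhds
  have hint : Tendsto (fun α : ℝ≥0∞ => ∫⁻ x, (P.rnDeriv Q x) ^ α.toReal ∂Q) (𝓝[>] 0)
      (𝓝 (Q {x | 0 < P.rnDeriv Q x})) := by
    have hset : MeasurableSet {x | 0 < P.rnDeriv Q x} :=
      measurableSet_lt measurable_const (Measure.measurable_rnDeriv P Q)
    rw [← lintegral_indicator_one hset]
    refine tendsto_lintegral_filter_of_dominated_convergence (fun x => 1 + P.rnDeriv Q x)
      ?_ ?_ ?_ ?_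
    · exact Eventually.of_forall fun α => (Measure.measurable_rnDeriv P Q).pow_const _
    · filter_upwards [hlt] with α hα
      refine Eventually.of_forall fun x => ?_
      have h1 : α.toReal ≤ 1 := by
        have := ENNReal.toReal_mono (by simp) hα.2.le
        simpa using this
      rcases le_total (P.rnDeriv Q x) 1 with h | h
      · exact (ENNReal.rpow_le_one h ENNReal.toReal_nonneg).trans le_self_add
      · calc (P.rnDeriv Q x) ^ α.toReal ≤ (P.rnDeriv Q x) ^ (1 : ℝ) :=
              ENNReal.rpow_le_rpow_of_exponent_le h h1
          _ = P.rnDeriv Q x := ENNReal.rpow_one _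
          _ ≤ 1 + P.rnDeriv Q x := le_add_self
    · rw [lintegral_add_left measurable_const]
      have := Measure.lintegral_rnDeriv_lt_top P Q
      simp [this.ne]
    · filter_upwards [Measure.rnDeriv_lt_top P Q] with x hx
      by_cases h0 : P.rnDeriv Q x = 0
      · have : ({x | 0 < P.rnDeriv Q x} : Set ℝ).indicator (1 : ℝ → ℝ≥0∞) x = 0 := by
          simp [h0]
        rw [this, h0]
        refine tendsto_const_nhds.congr' ?_
        filter_upwards [hlt] with α hα
        rw [ENNReal.zero_rpow_of_pos (ENNReal.toReal_pos hα.1.ne' (hα.2.trans (by simp)).ne)]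
      · have : ({x | 0 < P.rnDeriv Q x} : Set ℝ).indicator (1 : ℝ → ℝ≥0∞) x = 1 := by
          simp [pos_iff_ne_zero, h0]
        rw [this]
        lift P.rnDeriv Q x to NNReal using hx.ne with p hp
        have hp0 : p ≠ 0 := by simpa using h0
        have h2 : Tendsto (fun α : ℝ≥0∞ => p ^ α.toReal) (𝓝[>] 0) (𝓝 (p ^ (0 : ℝ))) :=
          (tendsto_const_nhds).nnrpow hre (Or.inl hp0)
        have h3 := ENNReal.tendsto_coe.2 h2
        simp only [NNReal.rpow_zero, ENNReal.coe_one] at h3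
        refine h3.congr fun α => ?_
        rw [ENNReal.coe_rpow_of_ne_zero hp0]
  have hlog := (ENNReal.continuous_log.tendsto _).comp hint
  have hcoef : Tendsto (fun α : ℝ≥0∞ => (((α.toReal - 1)⁻¹ : ℝ) : EReal)) (𝓝[>] 0)
      (𝓝 (((-1 : ℝ)) : EReal)) := by
    refine (continuous_coe_real_ereal.tendsto _).comp ?_
    have := (hre.sub_const 1).inv₀ (by norm_num)
    simpa using this
  have hmul := (EReal.continuousAt_mul (p := ((((-1 : ℝ)) : EReal),
    ENNReal.log (Q {x | 0 < P.rnDeriv Q x}))) (Or.inl (by norm_num)) (Or.inl (by norm_num))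
    (Or.inl (EReal.coe_ne_bot _)) (Or.inl (EReal.coe_ne_top _))).tendsto.comp
      (hcoef.prodMk_nhds hlog)
  have hzero : renyiDiv 0 P Q = ((-1 : ℝ) : EReal) *
      ENNReal.log (Q {x | 0 < P.rnDeriv Q x}) := by
    simp [renyiDiv]
  rw [hzero]
  refine hmul.congr' ?_
  filter_upwards [hlt] with α hα
  simp [renyiDiv, hα.1.ne', hα.2.ne, hα.2.not_gt, (hα.2.trans (by simp : (1 : ℝ≥0∞) < ∞)).ne]

/-! ### Achievable error functions -/

/-- `g : K → ℝ` is `α`-Rényi-achievable for the universal `(K, Q)`-simulation: one sequence of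
simulators `f₀, f₁, …` (measurable functions `ℝ → ℝ`) satisfies
`limsup_k D_α(P ∘ f_k⁻¹ ‖ Q) ≤ g P` for all seeds `P ∈ K` simultaneously. -/
def IsRenyiAchievable (α : ℝ≥0∞) (K : Set (ProbabilityMeasure ℝ)) (Q : ProbabilityMeasure ℝ)
    (g : K → ℝ) : Prop :=
  ∃ f : ℕ → ℝ → ℝ, (∀ k, Measurable (f k)) ∧
    ∀ P : K, limsup (fun k => renyiDiv α ((P.1 : Measure ℝ).map (f k)) (Q : Measure ℝ)) atTop
      ≤ (g P : EReal)

/-- The set `ℰ_Renyi^(α)(K, Q)` of all `α`-Rényi-achievable functions. -/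
def renyiAchievable (α : ℝ≥0∞) (K : Set (ProbabilityMeasure ℝ)) (Q : ProbabilityMeasure ℝ) :
    Set (K → ℝ) :=
  {g | IsRenyiAchievable α K Q g}

/-- `ℰ ≼ g`. -/
def SetPrec {ι : Type*} (ℰ : Set (ι → ℝ)) (g : ι → ℝ) : Prop :=
  ∃ g' ∈ ℰ, ∀ P, g' P ≤ g P

/-- `ℰ ≽ g`. -/
def SetSucc {ι : Type*} (ℰ : Set (ι → ℝ)) (g : ι → ℝ) : Prop :=
  ∀ g' ∈ ℰ, ∀ P, g P ≤ g' P

/-- `ℰ ≍ g`. -/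
def SetAsymp {ι : Type*} (ℰ : Set (ι → ℝ)) (g : ι → ℝ) : Prop :=
  SetPrec ℰ g ∧ SetSucc ℰ g

/-! ### Classes of seed distributions -/

/-- `P_ac(𝒜)`: the distributions on `𝒜` (that is, those on `ℝ` carried by `𝒜`) that are absolutely
continuous with respect to Lebesgue measure. -/
def acOn (𝒜 : Set ℝ) : Set (ProbabilityMeasure ℝ) :=
  {P | (P : Measure ℝ) ≪ volume ∧ (P : Measure ℝ) 𝒜ᶜ = 0}

/-- `A₀, A₁, …` is a partition of `𝒜` into countably many intervals of length at most `Δ`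
(empty cells are allowed, so that finite partitions are included). -/
structure IsIntervalPartition (𝒜 : Set ℝ) (Δ : ℝ) (A : ℕ → Set ℝ) : Prop where
  interval : ∀ i, (A i).OrdConnected
  disjoint : Pairwise fun i j => Disjoint (A i) (A j)
  iUnion_eq : ⋃ i, A i = 𝒜
  length_le : ∀ i, volume (A i) ≤ ENNReal.ofReal Δ

/-- The cell-averaged version `P_{|{A_i}}` of `P`: the measure with density `P(A_i) / |A_i|` on `A_i`
(null cells, where the quotient reads `0 / 0 = 0`, do not matter). -/
def cellAverage (P : Measure ℝ) (A : ℕ → Set ℝ) : Measure ℝ :=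
  volume.withDensity fun x => ∑' i, (A i).indicator (fun _ => P (A i) / volume (A i)) x

/-- `P_ac^(α)(𝒜)`: the absolutely continuous distributions `P` on `𝒜` with
`lim_{Δ ↓ 0} sup D_α(P ‖ P_{|{A_i}}) = 0`, the supremum being over all partitions `{A_i}` of `𝒜`
into intervals of length at most `Δ`. -/
def acRenyi (α : ℝ≥0∞) (𝒜 : Set ℝ) : Set (ProbabilityMeasure ℝ) :=
  {P | P ∈ acOn 𝒜 ∧
    Tendsto (fun Δ : ℝ => ⨆ (A : ℕ → Set ℝ) (_ : IsIntervalPartition 𝒜 Δ A),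
      renyiDiv α (P : Measure ℝ) (cellAverage (P : Measure ℝ) A)) (𝓝[>] 0) (𝓝 0)}

open scoped Classical in
/-- The seed class: `P_ac` for `α ∈ [0, 1)` and `P_ac^(α)(𝒜)` for `α ∈ [1, ∞]`. -/
def seedClass (α : ℝ≥0∞) (𝒜 : Set ℝ) : Set (ProbabilityMeasure ℝ) :=
  if α < 1 then acOn univ else acRenyi α 𝒜

end UniversalSimulation

end

/-!
The simulators are built from partitions into short intervals. On a nondegenerate cell `A i` the
uniform distribution can be mapped to any probability measure `Q`; gluing these maps gives one `f`
that sends the uniform distribution of *every* cell to `Q`. The cell average of a seed `P` is a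
mixture of these uniform distributions, so `f` sends it to `Q` although `f` does not depend on `P`
(`exists_measurable_map_cellAverage_eq`). Hence `P ∘ f⁻¹` is as close to `Q` as `P` is to its cell
average, in any sense of closeness that images do not increase.

For `α ≥ 1` this is the data processing inequality `renyiDiv_map_le`: the divergence is at most
`D_α(P ‖ cell average of P)`, which tends to `0` by the definition of the seed class. Partitions of
`𝒜` with arbitrarily small mesh exist as soon as the class is nonempty.

For `α < 1` the partition is a uniform grid of the line. By differentiation of measures the
densities of the cell averages converge almost everywhere to that of `P`, so the common mass of `P`
and its cell average tends to `1` (`tendsto_lintegral_min_gridDensity`). Common mass does not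
decrease under images, and `renyiDiv_le_of_le_of_le` bounds the divergence by
`(1 - α)⁻¹ log (1 / common mass)`.

No achievable function is negative anywhere because divergences of probability measures are
nonnegative (`renyiDiv_nonneg`); for `α ≥ 1` this is data processing for a constant map.
-/

namespace UniversalSimulation

/-! ### Rényi divergences of order below one -/

/-- For `α < 1` the Rényi divergence is `(α - 1)⁻¹ log H` with `H = ∫ (dP/dQ)^α dQ` (read as
`Q {dP/dQ > 0}` for `α = 0`) and a *negative* coefficient, so bounding it from above amounts to
bounding `H` from below. If a measure `ν` is dominated by both `P` and `Q`, its density satisfies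
`dν/dQ ≤ min (dP/dQ) 1`, which is at most the integrand of `H`; hence `ν univ ≤ H`. -/
theorem renyiDiv_le_of_le_of_le {α : ℝ≥0∞} (hα : α < 1) {P Q ν : Measure ℝ}
    [IsProbabilityMeasure P] [IsProbabilityMeasure Q] (hP : ν ≤ P) (hQ : ν ≤ Q) :
    renyiDiv α P Q ≤ (((α.toReal - 1)⁻¹ : ℝ) : EReal) * ENNReal.log (ν univ) := by
  have : IsFiniteMeasure ν := isFiniteMeasure_of_le P hP
  have hr1 : ν.rnDeriv Q ≤ᵐ[Q] 1 := Measure.rnDeriv_le_one_of_le hQ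
  have hrP : ν.rnDeriv Q ≤ᵐ[Q] P.rnDeriv Q := by
    have h := Measure.rnDeriv_add' (P - ν) ν Q
    rw [Measure.sub_add_cancel_of_le hP] at h
    filter_upwards [h] with x hx
    rw [hx]
    exact le_add_self
  have hν : ν univ = ∫⁻ x, ν.rnDeriv Q x ∂Q :=
    (Measure.lintegral_rnDeriv (Measure.absolutelyContinuous_of_le hQ)).symm
  have hα1 : α.toReal < 1 := by
    simpa using (ENNReal.toReal_lt_toReal hα.ne_top ENNReal.one_ne_top).2 hα
  have hc : (α.toReal - 1)⁻¹ ≤ 0 := inv_nonpos.2 (by linarith)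
  have key : ∀ H : ℝ≥0∞, ν univ ≤ H → (((α.toReal - 1)⁻¹ : ℝ) : EReal) * ENNReal.log H ≤
      (((α.toReal - 1)⁻¹ : ℝ) : EReal) * ENNReal.log (ν univ) := by
    intro H hH
    have h := mul_le_mul_of_nonneg_left (ENNReal.log_monotone hH)
      (show (0 : EReal) ≤ ((-(α.toReal - 1)⁻¹ : ℝ) : EReal) by exact_mod_cast neg_nonneg.2 hc)
    rw [EReal.coe_neg, EReal.neg_mul, EReal.neg_mul] at h
    exact EReal.neg_le_neg_iff.1 h
  rcases eq_or_ne α 0 with rfl | h0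
  · have hset : MeasurableSet {x | 0 < P.rnDeriv Q x} :=
      measurableSet_lt measurable_const (Measure.measurable_rnDeriv P Q)
    have hle : ν univ ≤ Q {x | 0 < P.rnDeriv Q x} := by
      rw [hν, ← lintegral_indicator_one hset]
      refine lintegral_mono_ae ?_
      filter_upwards [hr1, hrP] with x h1 h2
      by_cases hx : 0 < P.rnDeriv Q x
      · simpa [hx] using h1
      · simpa [hx] using h2.trans (not_lt.1 hx)
    simpa [renyiDiv] using key _ hle
  · have hle : ν univ ≤ ∫⁻ x, (P.rnDeriv Q x) ^ α.toReal ∂Q := by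
      rw [hν]
      refine lintegral_mono_ae ?_
      filter_upwards [hr1, hrP] with x h1 h2
      rcases le_total 1 (P.rnDeriv Q x) with h | h
      · exact h1.trans (ENNReal.one_le_rpow h (ENNReal.toReal_pos h0 hα.ne_top))
      · refine h2.trans ?_
        conv_lhs => rw [← ENNReal.rpow_one (P.rnDeriv Q x)]
        exact ENNReal.rpow_le_rpow_of_exponent_ge h hα1.le
    simpa [renyiDiv, h0, hα.ne, hα.not_gt, hα.ne_top] using key _ hle

theorem renyiDiv_nonneg_of_lt_one {α : ℝ≥0∞} (hα : α < 1) (P Q : Measure ℝ)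
    [IsProbabilityMeasure P] [IsProbabilityMeasure Q] : 0 ≤ renyiDiv α P Q := by
  rcases eq_or_ne α 0 with rfl | h0
  · have h : ENNReal.log (Q {x | 0 < P.rnDeriv Q x}) ≤ 0 :=
      ENNReal.log_le_zero_iff.2 prob_le_one
    simpa [renyiDiv] using EReal.neg_le_neg_iff.2 h
  · have hα1 : α.toReal < 1 := by
      simpa using (ENNReal.toReal_lt_toReal hα.ne_top ENNReal.one_ne_top).2 hα
    have hle : ∫⁻ x, (P.rnDeriv Q x) ^ α.toReal ∂Q ≤ 1 := by
      have h := ENNReal.lintegral_mul_norm_pow_le (μ := Q) (f := P.rnDeriv Q) (g := fun _ => 1)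
        (Measure.measurable_rnDeriv P Q).aemeasurable aemeasurable_const
        (p := α.toReal) (q := 1 - α.toReal) ENNReal.toReal_nonneg (by linarith) (by ring)
      simp only [ENNReal.one_rpow, mul_one, lintegral_const, measure_univ] at h
      refine h.trans (ENNReal.rpow_le_one ?_ ENNReal.toReal_nonneg)
      simpa using Measure.setLIntegral_rnDeriv_le (μ := P) (ν := Q) univ
    have hmul : 0 ≤ (((α.toReal - 1)⁻¹ : ℝ) : EReal) *
        ENNReal.log (∫⁻ x, (P.rnDeriv Q x) ^ α.toReal ∂Q) :=
      EReal.mul_nonneg_iff.2 (Or.inr ⟨by exact_mod_cast inv_nonpos.2 (by linarith),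
        ENNReal.log_le_zero_iff.2 hle⟩)
    simpa [renyiDiv, h0, hα.ne, hα.not_gt, hα.ne_top] using hmul

/-! ### The data processing inequality for orders at least one -/

theorem ofReal_integral_toReal_rnDeriv_rpow {X : Type*} {mX : MeasurableSpace X} {a : ℝ}
    (ha : 0 ≤ a) {P N : Measure X} [IsFiniteMeasure P] [IsFiniteMeasure N]
    (h : Integrable (fun x => (P.rnDeriv N x).toReal ^ a) N) :
    ENNReal.ofReal (∫ x, (P.rnDeriv N x).toReal ^ a ∂N) = ∫⁻ x, (P.rnDeriv N x) ^ a ∂N := by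
  rw [ofReal_integral_eq_lintegral_ofReal h
    (Eventually.of_forall fun x => Real.rpow_nonneg ENNReal.toReal_nonneg _)]
  refine lintegral_congr_ae ?_
  filter_upwards [Measure.rnDeriv_lt_top P N] with x hx
  rw [← ENNReal.ofReal_rpow_of_nonneg ENNReal.toReal_nonneg ha, ENNReal.ofReal_toReal hx.ne]

/-- Data processing for the Hellinger integral `∫ (dP/dR)^a dR`: the density of the image measures
is the conditional expectation of `dP/dR`, and `x ↦ x ^ a` is convex. -/
theorem lintegral_rnDeriv_map_rpow_le {X Y : Type*} {mX : MeasurableSpace X}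
    {mY : MeasurableSpace Y} {a : ℝ} (ha : 1 < a) {P N : Measure X} [IsFiniteMeasure P]
    [IsFiniteMeasure N] (hPN : P ≪ N) {f : X → Y} (hf : Measurable f) :
    ∫⁻ y, ((P.map f).rnDeriv (N.map f) y) ^ a ∂(N.map f) ≤ ∫⁻ x, (P.rnDeriv N x) ^ a ∂N := by
  have ha0 : 0 ≤ a := by linarith
  by_cases htop : ∫⁻ x, (P.rnDeriv N x) ^ a ∂N = ∞
  · simp [htop]
  have hcvx : ConvexOn ℝ (Ici 0) fun x : ℝ => x ^ a := convexOn_rpow ha.le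
  have hcont : Continuous fun x : ℝ => x ^ a := Real.continuous_rpow_const ha0
  have hint : Integrable (fun x => (P.rnDeriv N x).toReal ^ a) N := by
    simp_rw [ENNReal.toReal_rpow]
    exact integrable_toReal_of_lintegral_ne_top
      ((Measure.measurable_rnDeriv P N).pow_const a).aemeasurable htop
  have hle := hcvx.comp_rnDeriv_map_le hPN hf hcont.stronglyMeasurable
    hcont.continuousWithinAt hint
  have hint' := hcvx.integrable_comp_rnDeriv_map hPN hf hcont.stronglyMeasurable
    hcont.continuousWithinAt hint
  have hreal : ∫ y, ((P.map f).rnDeriv (N.map f) y).toReal ^ a ∂(N.map f) ≤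
      ∫ x, (P.rnDeriv N x).toReal ^ a ∂N := by
    rw [integral_map hf.aemeasurable hint'.aestronglyMeasurable,
      ← integral_condExp hf.comap_le (f := fun x => (P.rnDeriv N x).toReal ^ a)]
    exact integral_mono_ae
      ((integrable_map_measure hint'.aestronglyMeasurable hf.aemeasurable).1 hint')
      integrable_condExp hle
  rw [← ofReal_integral_toReal_rnDeriv_rpow ha0 hint',
    ← ofReal_integral_toReal_rnDeriv_rpow ha0 hint]
  exact ENNReal.ofReal_le_ofReal hreal

/-- Data processing for the essential supremum of the density: it is the least `c` with
`P ≤ c • N`, and such a domination passes to image measures. -/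
theorem essSup_rnDeriv_map_le {X Y : Type*} {mX : MeasurableSpace X}
    {mY : MeasurableSpace Y} {P N : Measure X} [IsFiniteMeasure P]
    [IsFiniteMeasure N] (hPN : P ≪ N) {f : X → Y} (hf : Measurable f) :
    essSup ((P.map f).rnDeriv (N.map f)) (P.map f) ≤ essSup (P.rnDeriv N) P := by
  set c := essSup (P.rnDeriv N) P with hc
  have hcP : ∀ᵐ x ∂P, P.rnDeriv N x ≤ c := ae_le_essSup
  have hcN : ∀ᵐ x ∂N, P.rnDeriv N x ≤ c := by
    have h := hcP
    rw [← Measure.withDensity_rnDeriv_eq P N hPN,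
      ae_withDensity_iff (Measure.measurable_rnDeriv P N)] at h
    rw [Measure.withDensity_rnDeriv_eq P N hPN] at h
    filter_upwards [h] with x hx
    by_cases h0 : P.rnDeriv N x = 0
    · simp [h0]
    · exact hx h0
  have hdom : P ≤ c • N := by
    rw [← Measure.withDensity_rnDeriv_eq P N hPN, ← withDensity_const]
    exact withDensity_mono hcN
  have hmap : P.map f ≤ c • N.map f := by
    rw [← Measure.map_smul]
    exact Measure.map_mono hdom hf
  refine essSup_le_of_ae_le c ((hPN.map hf).ae_le ?_)
  refine ae_le_of_forall_setLIntegral_le_of_sigmaFinite (Measure.measurable_rnDeriv _ _) ?_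
  intro s hs _
  calc ∫⁻ y in s, (P.map f).rnDeriv (N.map f) y ∂(N.map f) ≤ P.map f s :=
        Measure.setLIntegral_rnDeriv_le s
    _ ≤ (c • N.map f) s := hmap s
    _ = ∫⁻ _ in s, c ∂(N.map f) := by simp

/-- The data processing inequality for the Rényi divergences of order `α ≥ 1`. -/
theorem renyiDiv_map_le {α : ℝ≥0∞} (hα : 1 ≤ α) (P N : Measure ℝ) [IsProbabilityMeasure P]
    [IsProbabilityMeasure N] {f : ℝ → ℝ} (hf : Measurable f) :
    renyiDiv α (P.map f) (N.map f) ≤ renyiDiv α P N := by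
  have h0 : α ≠ 0 := (zero_lt_one.trans_le hα).ne'
  rcases hα.eq_or_lt with rfl | hα
  · simpa [renyiDiv] using InformationTheory.klDiv_map_le P N hf
  by_cases hPN : P ≪ N
  swap
  · simp [renyiDiv, h0, hα.ne', hα, hPN]
  have hmap : P.map f ≪ N.map f := hPN.map hf
  rcases eq_or_ne α ∞ with rfl | htop
  · simpa [renyiDiv, hPN, hmap] using ENNReal.log_monotone (essSup_rnDeriv_map_le hPN hf)
  · have hα1 : 1 < α.toReal := by
      simpa using (ENNReal.toReal_lt_toReal ENNReal.one_ne_top htop).2 hα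
    have h := mul_le_mul_of_nonneg_left
      (ENNReal.log_monotone (lintegral_rnDeriv_map_rpow_le hα1 hPN hf))
      (show (0 : EReal) ≤ (((α.toReal - 1)⁻¹ : ℝ) : EReal) by
        exact_mod_cast inv_nonneg.2 (by linarith))
    simpa [renyiDiv, h0, hα.ne', hPN, hmap, htop] using h

theorem renyiDiv_self_of_one_le {α : ℝ≥0∞} (hα : 1 ≤ α) (P : Measure ℝ)
    [IsProbabilityMeasure P] : renyiDiv α P P = 0 := by
  have h0 : α ≠ 0 := (zero_lt_one.trans_le hα).ne'
  rcases hα.eq_or_lt with rfl | hα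
  · simp [renyiDiv]
  have hd := Measure.rnDeriv_self P
  rcases eq_or_ne α ∞ with rfl | htop
  · simp [renyiDiv, essSup_congr_ae hd, Measure.AbsolutelyContinuous.refl]
  · have h : ∫⁻ x, (P.rnDeriv P x) ^ α.toReal ∂P = 1 := by
      rw [lintegral_congr_ae (g := fun _ => 1) (hd.mono fun x hx => by simp [hx])]
      simp
    simp [renyiDiv, h0, hα.ne', htop, h, Measure.AbsolutelyContinuous.refl]

theorem renyiDiv_nonneg (α : ℝ≥0∞) (P Q : Measure ℝ)
    [IsProbabilityMeasure P] [IsProbabilityMeasure Q] : 0 ≤ renyiDiv α P Q := by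
  rcases lt_or_ge α 1 with hα | hα
  · exact renyiDiv_nonneg_of_lt_one hα P Q
  · -- A constant map sends `P` and `Q` to the same Dirac measure.
    have h := renyiDiv_map_le hα P Q (measurable_const (a := (0 : ℝ)))
    simpa [Measure.map_const, renyiDiv_self_of_one_le hα] using h

/-! ### Simulating the target from a uniform distribution on a cell -/

/-- A bounded nondegenerate interval differs from the closed interval between its infimum and
supremum by a null set. -/
theorem exists_ae_eq_Icc_of_ordConnected {s : Set ℝ} (hs : s.OrdConnected)
    (h0 : volume s ≠ 0) (htop : volume s ≠ ∞) : ∃ a b : ℝ, a < b ∧ s =ᵐ[volume] Icc a b := by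
  have hne : s.Nonempty := nonempty_of_measure_ne_zero h0
  have hab : BddAbove s := by
    by_contra h
    obtain ⟨x, hx⟩ := hne
    refine htop (top_le_iff.1 ?_)
    rw [← Real.volume_Ici (a := x)]
    refine measure_mono fun y hy => ?_
    obtain ⟨z, hz, hyz⟩ := not_bddAbove_iff.1 h y
    exact hs.out hx hz ⟨hy, hyz.le⟩
  have hbb : BddBelow s := by
    by_contra h
    obtain ⟨x, hx⟩ := hne
    refine htop (top_le_iff.1 ?_)
    rw [← Real.volume_Iic (a := x)]
    refine measure_mono fun y hy => ?_
    obtain ⟨z, hz, hyz⟩ := not_bddBelow_iff.1 h y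
    exact hs.out hz hx ⟨hyz.le, hy⟩
  have hsub := subset_Icc_csInf_csSup hbb hab
  have hsup := IsConnected.Ioo_csInf_csSup_subset ⟨hne, hs.isPreconnected⟩ hbb hab
  refine ⟨sInf s, sSup s, ?_, ?_⟩
  · by_contra h
    refine h0 (measure_mono_null hsub ?_)
    rw [Real.volume_Icc]
    exact ENNReal.ofReal_of_nonpos (by linarith [not_lt.1 h])
  · exact hsub.eventuallyLE.antisymm (Ioo_ae_eq_Icc.symm.le.trans hsup.eventuallyLE)

/-- Every probability measure is the image of Lebesgue measure on `[0, 1]`. -/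
theorem exists_measurable_map_restrict_Icc_eq (Q : Measure ℝ) [IsProbabilityMeasure Q] :
    ∃ g : ℝ → ℝ, Measurable g ∧ (volume.restrict (Icc (0 : ℝ) 1)).map g = Q := by
  obtain ⟨f, hf, hfQ⟩ := Measure.exists_measurable_map_eq Q
  have hproj : Measurable (projIcc (0 : ℝ) 1 zero_le_one) := continuous_projIcc.measurable
  refine ⟨fun x => f (projIcc 0 1 zero_le_one x), hf.comp hproj, ?_⟩
  rw [← unitInterval.measurePreserving_coe.map_eq,
    Measure.map_map (g := fun x => f (projIcc 0 1 zero_le_one x)) (hf.comp hproj)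
      measurable_subtype_coe, ← hfQ]
  congr 1
  funext u
  simp

/-- Every probability measure is the image of the uniform distribution on a nondegenerate interval
of finite length. -/
theorem exists_measurable_map_restrict_eq (Q : Measure ℝ) [IsProbabilityMeasure Q] {s : Set ℝ}
    (hs : s.OrdConnected) (h0 : volume s ≠ 0) (htop : volume s ≠ ∞) :
    ∃ g : ℝ → ℝ, Measurable g ∧ (volume.restrict s).map g = volume s • Q := by
  obtain ⟨a, b, hab, hae⟩ := exists_ae_eq_Icc_of_ordConnected hs h0 htop
  obtain ⟨g, hg, hgQ⟩ := exists_measurable_map_restrict_Icc_eq Q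
  have hba : 0 < b - a := sub_pos.2 hab
  let h : ℝ → ℝ := fun x => (b - a)⁻¹ * (x - a)
  have hh : Measurable h := by fun_prop
  have hvol : volume.map h = ENNReal.ofReal (b - a) • volume := by
    have h1 : h = (fun x => (b - a)⁻¹ * x) ∘ fun x => x - a := rfl
    rw [h1, ← Measure.map_map (by fun_prop) (by fun_prop), map_sub_right_eq_self,
      Real.map_volume_mul_left (inv_ne_zero hba.ne'), inv_inv, abs_of_pos hba]
  have hpre : h ⁻¹' Icc 0 1 = Icc a b := by
    ext x
    simp only [h, mem_preimage, mem_Icc, inv_mul_le_iff₀ hba]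
    rw [mul_nonneg_iff_of_pos_left (inv_pos.2 hba)]
    constructor <;> rintro ⟨h1, h2⟩ <;> constructor <;> linarith
  refine ⟨g ∘ h, hg.comp hh, ?_⟩
  rw [Measure.restrict_congr_set hae, ← Measure.map_map hg hh, ← hpre,
    ← Measure.restrict_map hh measurableSet_Icc, hvol, Measure.restrict_smul, Measure.map_smul,
    hgQ, measure_congr hae, Real.volume_Icc]

/-! ### Cell averages and the simulator of a partition -/

theorem cellAverage_eq_sum (P : Measure ℝ) {A : ℕ → Set ℝ} (hA : ∀ i, MeasurableSet (A i)) :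
    cellAverage P A = Measure.sum fun i => (P (A i) / volume (A i)) • volume.restrict (A i) := by
  have h : (fun x => ∑' i, (A i).indicator (fun _ => P (A i) / volume (A i)) x) =
      ∑' i, (A i).indicator (fun _ => P (A i) / volume (A i)) := by
    funext x
    rw [tsum_apply (Pi.summable.2 fun _ => ENNReal.summable)]
  rw [cellAverage, h, withDensity_tsum fun i => measurable_const.indicator (hA i)]
  simp_rw [withDensity_indicator (hA _), withDensity_const]

/-- For a partition into intervals of finite length there is one map sending the uniform
distribution of every cell to `Q`.  A cell-averaged distribution is a mixture of these uniform
distributions, so the map sends it to `Q`, whatever the weights are. -/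
theorem exists_measurable_map_cellAverage_eq (Q : Measure ℝ) [IsProbabilityMeasure Q]
    {𝒜 : Set ℝ} {Δ : ℝ} {A : ℕ → Set ℝ} (hA : IsIntervalPartition 𝒜 Δ A) :
    ∃ f : ℝ → ℝ, Measurable f ∧ ∀ P ∈ acOn 𝒜, (cellAverage (P : Measure ℝ) A).map f = Q := by
  have hmeas : ∀ i, MeasurableSet (A i) := fun i => (hA.interval i).measurableSet
  have htop : ∀ i, volume (A i) ≠ ∞ := fun i =>
    ((hA.length_le i).trans_lt ENNReal.ofReal_lt_top).ne
  have hcell : ∀ i, ∃ g : ℝ → ℝ, Measurable g ∧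
      (volume.restrict (A i)).map g = volume (A i) • Q := by
    intro i
    by_cases h0 : volume (A i) = 0
    · exact ⟨id, measurable_id, by simp [h0, Measure.restrict_eq_zero.2 h0]⟩
    · exact exists_measurable_map_restrict_eq Q (hA.interval i) h0 (htop i)
  choose g hg hgQ using hcell
  obtain ⟨f, hf, hfg⟩ := exists_measurable_piecewise A hmeas g hg fun i j hij x hx =>
    ((hA.disjoint hij).le_bot hx).elim
  refine ⟨f, hf, fun P hP => ?_⟩
  have hmap : ∀ i, (volume.restrict (A i)).map f = volume (A i) • Q := by
    intro i
    rw [← hgQ i]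
    refine Measure.map_congr ?_
    filter_upwards [ae_restrict_mem (hmeas i)] with x hx using hfg i hx
  have hw : ∀ i, (P : Measure ℝ) (A i) / volume (A i) * volume (A i) = (P : Measure ℝ) (A i) := by
    intro i
    by_cases h0 : volume (A i) = 0
    · simp [h0, hP.1 h0]
    · exact ENNReal.div_mul_cancel h0 (htop i)
  have hsum : ∑' i, (P : Measure ℝ) (A i) = 1 := by
    rw [← measure_iUnion hA.disjoint hmeas, hA.iUnion_eq]
    exact (prob_compl_eq_zero_iff₀
      (by rw [← hA.iUnion_eq]; exact (MeasurableSet.iUnion hmeas).nullMeasurableSet)).1 hP.2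
  rw [cellAverage_eq_sum _ hmeas]
  ext s hs
  rw [Measure.map_apply hf hs, Measure.sum_apply _ (hf hs)]
  have hterm : ∀ i, (((P : Measure ℝ) (A i) / volume (A i)) • volume.restrict (A i)) (f ⁻¹' s) =
      (P : Measure ℝ) (A i) * Q s := by
    intro i
    rw [Measure.smul_apply, ← Measure.map_apply hf hs, hmap, Measure.smul_apply, smul_eq_mul,
      smul_eq_mul, ← mul_assoc, hw]
  have : ∑' i, (((P : Measure ℝ) (A i) / volume (A i)) • volume.restrict (A i)) (f ⁻¹' s) = Q s := by
    simp_rw [hterm]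
    rw [ENNReal.tsum_mul_right, hsum, one_mul]
  exact this

/-! ### The uniform grid and differentiation of measures -/

/-- The cells `[j δ, (j + 1) δ)`, `j ∈ ℤ`, of the grid of mesh `δ` on the real line, enumerated by
the natural numbers. -/
def gridCell (δ : ℝ) (i : ℕ) : Set ℝ :=
  Ico (Equiv.intEquivNat.symm i * δ) ((Equiv.intEquivNat.symm i + 1) * δ)

theorem mem_gridCell_iff {δ : ℝ} (hδ : 0 < δ) {x : ℝ} {i : ℕ} :
    x ∈ gridCell δ i ↔ ⌊x / δ⌋ = Equiv.intEquivNat.symm i := by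
  rw [gridCell, mem_Ico, Int.floor_eq_iff, le_div_iff₀ hδ, div_lt_iff₀ hδ]

theorem isIntervalPartition_gridCell {δ : ℝ} (hδ : 0 < δ) :
    IsIntervalPartition univ δ (gridCell δ) where
  interval _ := ordConnected_Ico
  disjoint i j hij := by
    refine Set.disjoint_left.2 fun x hi hj => hij ?_
    rw [mem_gridCell_iff hδ] at hi hj
    exact Equiv.intEquivNat.symm.injective (hi.symm.trans hj)
  iUnion_eq := by
    refine eq_univ_of_forall fun x => mem_iUnion.2 ⟨Equiv.intEquivNat ⌊x / δ⌋, ?_⟩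
    simp [mem_gridCell_iff hδ]
  length_le i := by
    rw [gridCell, Real.volume_Ico]
    exact ENNReal.ofReal_le_ofReal (by linarith)

/-- The density of the cell average of `P` over the grid of mesh `δ`. -/
noncomputable def gridDensity (P : Measure ℝ) (δ : ℝ) (x : ℝ) : ℝ≥0∞ :=
  ∑' i, (gridCell δ i).indicator (fun _ => P (gridCell δ i) / volume (gridCell δ i)) x

theorem measurable_gridDensity (P : Measure ℝ) (δ : ℝ) : Measurable (gridDensity P δ) :=
  Measurable.tsum fun _ => measurable_const.indicator measurableSet_Ico

/-- For `P ≪ volume` the half-open cell that contains `x` may be replaced by a closed ball. -/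
theorem gridDensity_eq {P : Measure ℝ} (hP : P ≪ volume) {δ : ℝ} (hδ : 0 < δ) (x : ℝ) :
    gridDensity P δ x = P (Metric.closedBall ((⌊x / δ⌋ + 1 / 2) * δ) (δ / 2)) /
      volume (Metric.closedBall ((⌊x / δ⌋ + 1 / 2) * δ) (δ / 2)) := by
  have hx : x ∈ gridCell δ (Equiv.intEquivNat ⌊x / δ⌋) := by simp [mem_gridCell_iff hδ]
  have hball : Metric.closedBall ((⌊x / δ⌋ + 1 / 2) * δ) (δ / 2) =
      Icc (⌊x / δ⌋ * δ) ((⌊x / δ⌋ + 1) * δ) := by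
    rw [Real.closedBall_eq_Icc]
    congr 1 <;> ring
  have hae : gridCell δ (Equiv.intEquivNat ⌊x / δ⌋) =ᵐ[volume]
      Metric.closedBall ((⌊x / δ⌋ + 1 / 2) * δ) (δ / 2) := by
    rw [hball, gridCell, Equiv.symm_apply_apply]
    exact Ico_ae_eq_Icc
  rw [gridDensity, tsum_eq_single (Equiv.intEquivNat ⌊x / δ⌋), indicator_of_mem hx,
    measure_congr hae, measure_congr (hP.ae_eq hae)]
  intro i hi
  refine indicator_of_notMem (fun h => hi ?_) _
  rw [mem_gridCell_iff hδ] at h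
  rw [h, Equiv.apply_symm_apply]

theorem ae_tendsto_gridDensity {P : Measure ℝ} [IsFiniteMeasure P] (hP : P ≪ volume) {δ : ℕ → ℝ}
    (hpos : ∀ k, 0 < δ k) (hδ : Tendsto δ atTop (𝓝 0)) :
    ∀ᵐ x, Tendsto (fun k => gridDensity P (δ k) x) atTop (𝓝 (P.rnDeriv volume x)) := by
  filter_upwards [(IsUnifLocDoublingMeasure.vitaliFamily (volume : Measure ℝ) 1).ae_tendsto_rnDeriv
    P] with x hx
  have hlim : Tendsto (fun k => δ k / 2) atTop (𝓝[>] 0) := by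
    refine tendsto_nhdsWithin_iff.2 ⟨by simpa using hδ.div_const 2, ?_⟩
    exact Eventually.of_forall fun k => half_pos (hpos k)
  have hball := IsUnifLocDoublingMeasure.tendsto_closedBall_filterAt (volume : Measure ℝ)
    (K := 1) (x := x) (fun k => (⌊x / δ k⌋ + 1 / 2) * δ k) _ hlim (Eventually.of_forall fun k => by
      have h1 := (le_div_iff₀ (hpos k)).1 (Int.floor_le (x / δ k))
      have h2 := (div_lt_iff₀ (hpos k)).1 (Int.lt_floor_add_one (x / δ k))
      rw [Real.closedBall_eq_Icc]
      constructor <;> linarith)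
  exact (hx.comp hball).congr fun k => (gridDensity_eq hP (hpos k) x).symm

/-- The common mass of `P` and its grid averages tends to `1`; the minimum of the two densities
converges pointwise and is dominated by the density of `P`. -/
theorem tendsto_lintegral_min_gridDensity {P : Measure ℝ} [IsProbabilityMeasure P]
    (hP : P ≪ volume) {δ : ℕ → ℝ} (hpos : ∀ k, 0 < δ k) (hδ : Tendsto δ atTop (𝓝 0)) :
    Tendsto (fun k => ∫⁻ x, min (P.rnDeriv volume x) (gridDensity P (δ k) x)) atTop (𝓝 1) := by
  have hint : ∫⁻ x, P.rnDeriv volume x = 1 := by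
    rw [Measure.lintegral_rnDeriv hP, measure_univ]
  rw [← hint]
  refine tendsto_lintegral_of_dominated_convergence (P.rnDeriv volume)
    (fun k => (Measure.measurable_rnDeriv _ _).min (measurable_gridDensity P _))
    (fun k => Eventually.of_forall fun x => min_le_left _ _) (by simp [hint]) ?_
  filter_upwards [ae_tendsto_gridDensity hP hpos hδ] with x hx
  simpa using (tendsto_const_nhds (x := P.rnDeriv volume x)).min hx

/-! ### Universal simulators -/

/-- A simulator adapted to a fine grid makes the Rényi divergence of order `α < 1` vanish: the image
of the common part of `P` and its cell average lies below both `P ∘ f⁻¹` and `Q`. -/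
theorem exists_simulators_of_lt_one {α : ℝ≥0∞} (hα : α < 1) (Q : ProbabilityMeasure ℝ) :
    ∃ f : ℕ → ℝ → ℝ, (∀ k, Measurable (f k)) ∧ ∀ P ∈ acOn univ,
      limsup (fun k => renyiDiv α ((P : Measure ℝ).map (f k)) (Q : Measure ℝ)) atTop ≤ 0 := by
  let δ : ℕ → ℝ := fun k => 1 / ((k : ℝ) + 1)
  have hpos : ∀ k, 0 < δ k := fun k => Nat.one_div_pos_of_nat
  have hδ : Tendsto δ atTop (𝓝 0) := tendsto_one_div_add_atTop_nhds_zero_nat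
  choose f hf hfQ using fun k =>
    exists_measurable_map_cellAverage_eq (Q : Measure ℝ) (isIntervalPartition_gridCell (hpos k))
  refine ⟨f, hf, fun P hP => ?_⟩
  have hac : (P : Measure ℝ) ≪ volume := hP.1
  let m : ℕ → ℝ → ℝ≥0∞ := fun k x =>
    min ((P : Measure ℝ).rnDeriv volume x) (gridDensity (P : Measure ℝ) (δ k) x)
  have hbound : ∀ k, renyiDiv α ((P : Measure ℝ).map (f k)) (Q : Measure ℝ) ≤
      (((α.toReal - 1)⁻¹ : ℝ) : EReal) * ENNReal.log (∫⁻ x, m k x) := by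
    intro k
    have : IsProbabilityMeasure ((P : Measure ℝ).map (f k)) :=
      Measure.isProbabilityMeasure_map (hf k).aemeasurable
    have hle1 : (volume.withDensity (m k)).map (f k) ≤ (P : Measure ℝ).map (f k) := by
      refine Measure.map_mono ?_ (hf k)
      conv_rhs => rw [← Measure.withDensity_rnDeriv_eq (P : Measure ℝ) volume hac]
      exact withDensity_mono (Eventually.of_forall fun x => min_le_left _ _)
    have hle2 : (volume.withDensity (m k)).map (f k) ≤ (Q : Measure ℝ) := by
      rw [← hfQ k P hP]
      exact Measure.map_mono
        (withDensity_mono (Eventually.of_forall fun x => min_le_right _ _)) (hf k)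
    have h := renyiDiv_le_of_le_of_le hα hle1 hle2
    rwa [Measure.map_apply (hf k) MeasurableSet.univ, preimage_univ,
      withDensity_apply _ MeasurableSet.univ, Measure.restrict_univ] at h
  have hlog : Tendsto (fun k => ENNReal.log (∫⁻ x, m k x)) atTop (𝓝 0) := by
    rw [← ENNReal.log_one]
    exact (ENNReal.continuous_log.tendsto _).comp (tendsto_lintegral_min_gridDensity hac hpos hδ)
  have hlim : Tendsto (fun k => (((α.toReal - 1)⁻¹ : ℝ) : EReal) * ENNReal.log (∫⁻ x, m k x)) atTop
      (𝓝 0) := by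
    have h := (EReal.continuousAt_mul (p := ((((α.toReal - 1)⁻¹ : ℝ) : EReal), (0 : EReal)))
      (Or.inr (by simp)) (Or.inr (by simp)) (Or.inl (EReal.coe_ne_bot _))
      (Or.inl (EReal.coe_ne_top _))).tendsto.comp (tendsto_const_nhds.prodMk_nhds hlog)
    simpa [Function.comp_def] using h
  exact (limsup_le_limsup (Eventually.of_forall hbound)).trans hlim.limsup_eq.le

/-- A seed class of order `α ≥ 1` can only be nonempty if `𝒜` has arbitrarily fine partitions: the
supremum over an empty family of partitions would be `⊥`, not close to `0`. -/
theorem exists_isIntervalPartition_of_mem_acRenyi {α : ℝ≥0∞} {𝒜 : Set ℝ}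
    {P : ProbabilityMeasure ℝ} (hP : P ∈ acRenyi α 𝒜) {Δ : ℝ} (hΔ : 0 < Δ) :
    ∃ A, IsIntervalPartition 𝒜 Δ A := by
  have hev := (hP.2.eventually (lt_mem_nhds (EReal.bot_lt_zero))).and
    (Ioo_mem_nhdsGT hΔ)
  obtain ⟨ε, hbot, hε⟩ := hev.exists
  by_contra hne
  refine hbot.ne' (iSup₂_eq_bot.2 fun A hA => (hne ⟨A, hA.interval, hA.disjoint, hA.iUnion_eq,
    fun i => (hA.length_le i).trans (ENNReal.ofReal_le_ofReal hε.2.le)⟩).elim)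

/-- For `α ≥ 1` data processing bounds the divergence from `Q` of the image of `P` by the divergence
of `P` from its cell average. -/
theorem exists_simulators_of_one_le {α : ℝ≥0∞} (hα : 1 ≤ α) (𝒜 : Set ℝ)
    (Q : ProbabilityMeasure ℝ) :
    ∃ f : ℕ → ℝ → ℝ, (∀ k, Measurable (f k)) ∧ ∀ P ∈ acRenyi α 𝒜,
      limsup (fun k => renyiDiv α ((P : Measure ℝ).map (f k)) (Q : Measure ℝ)) atTop ≤ 0 := by
  rcases (acRenyi α 𝒜).eq_empty_or_nonempty with hempty | ⟨P₀, hP₀⟩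
  · exact ⟨fun _ => id, fun _ => measurable_id, by simp [hempty]⟩
  let δ : ℕ → ℝ := fun k => 1 / ((k : ℝ) + 1)
  have hpos : ∀ k, 0 < δ k := fun k => Nat.one_div_pos_of_nat
  have hδ : Tendsto δ atTop (𝓝[>] 0) := tendsto_nhdsWithin_iff.2
    ⟨tendsto_one_div_add_atTop_nhds_zero_nat, Eventually.of_forall hpos⟩
  choose A hA using fun k => exists_isIntervalPartition_of_mem_acRenyi hP₀ (hpos k)
  choose f hf hfQ using fun k => exists_measurable_map_cellAverage_eq (Q : Measure ℝ) (hA k)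
  refine ⟨f, hf, fun P hP => ?_⟩
  refine (limsup_le_limsup (Eventually.of_forall fun k => ?_)).trans
    (hP.2.comp hδ).limsup_eq.le
  have hmap := hfQ k P hP.1
  have : IsProbabilityMeasure (cellAverage (P : Measure ℝ) (A k)) := by
    constructor
    rw [← preimage_univ (f := f k), ← Measure.map_apply (hf k) MeasurableSet.univ, hmap,
      measure_univ]
  calc renyiDiv α ((P : Measure ℝ).map (f k)) (Q : Measure ℝ)
      = renyiDiv α ((P : Measure ℝ).map (f k)) ((cellAverage (P : Measure ℝ) (A k)).map (f k)) := by
        rw [hmap]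
    _ ≤ renyiDiv α (P : Measure ℝ) (cellAverage (P : Measure ℝ) (A k)) :=
        renyiDiv_map_le hα _ _ (hf k)
    _ ≤ _ := le_iSup₂_of_le (A k) (hA k) le_rfl

end UniversalSimulation

theorem mainTheorem8 (α : ℝ≥0∞) (𝒜 : Set ℝ) (h𝒜 : MeasurableSet 𝒜)
    (Q : ProbabilityMeasure ℝ) :
    UniversalSimulation.SetAsymp
      (UniversalSimulation.renyiAchievable α (UniversalSimulation.seedClass α 𝒜) Q)
      (fun _ => 0) := by
  refine ⟨⟨fun _ => 0, ?_, fun _ => le_rfl⟩, ?_⟩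
  · rcases lt_or_ge α 1 with hα | hα
    · obtain ⟨f, hf, h⟩ := UniversalSimulation.exists_simulators_of_lt_one hα Q
      refine ⟨f, hf, fun P => ?_⟩
      have hP : P.1 ∈ UniversalSimulation.acOn univ := by
        simpa only [UniversalSimulation.seedClass, if_pos hα] using P.2
      simpa using h P.1 hP
    · obtain ⟨f, hf, h⟩ := UniversalSimulation.exists_simulators_of_one_le hα 𝒜 Q
      refine ⟨f, hf, fun P => ?_⟩
      have hP : P.1 ∈ UniversalSimulation.acRenyi α 𝒜 := by
        simpa only [UniversalSimulation.seedClass, if_neg hα.not_gt] using P.2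
      simpa using h P.1 hP
  · rintro g ⟨f, hf, h⟩ P
    have hlim : (0 : EReal) ≤ limsup (fun k => UniversalSimulation.renyiDiv α
        ((P.1 : Measure ℝ).map (f k)) (Q : Measure ℝ)) atTop := by
      refine le_limsup_of_frequently_le (Frequently.of_forall fun k => ?_)
      have : IsProbabilityMeasure ((P.1 : Measure ℝ).map (f k)) :=
        Measure.isProbabilityMeasure_map (hf k).aemeasurable
      exact UniversalSimulation.renyiDiv_nonneg α _ _
    exact_mod_cast hlim.trans (h P)
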